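/- Let $k$ be a field, let $n\ge 0$ be an integer, let $S=k[x_1,\ldots,x_n]$, and let $M$ be a monomial ideal of $S$, that is, an ideal generated by monomials. A multigraded free resolution of $S/M$ is an exact sequence \[\cdots\to F_2\xrightarrow{f_2}F_1\xrightarrow{f_1}F_0\xrightarrow{f_0}S/M\to 0\] in which every $F_i$ is a free $S$-module of finite rank with a basis whose elements are assigned multidegrees in $\mathbb{N}^n$, and every $f_i$ preserves multidegrees; it is minimal if no entry of the matrices of $f_1,f_2,\ldots$ (in these bases) is invertible. Then $S/M$ has a minimal multigraded free resolution, and every such resolution satisfies \[\max\{i:\operatorname{rank}F_i\neq 0\}\le n\] (the maximum of the empty set, which occurs for $M=S$, being $-\infty$). In other words, the projective dimension of $S/M$ is at most $n$: $\operatorname{pd}(S/M)\le n$. The same bound holds for the projective dimension of the $S$-module $S/M$ in the homological sense, that is, $\operatorname{Ext}_S^i(S/M,N)=0$ for all $i>n$ and all $S$-modules $N$. -/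

import Mathlib

/-- A monomial ideal of `k[x_1, …, x_n]`: an ideal generated by a set of monomials
(by Dickson's lemma a finite set of monomials then suffices). -/
def IsMonomialIdeal {k : Type*} [Field k] {n : ℕ} (M : Ideal (MvPolynomial (Fin n) k)) : Prop :=
  ∃ G : Set (Fin n →₀ ℕ), M = Ideal.span ((fun a => MvPolynomial.monomial a (1 : k)) '' G)

/-- A multigraded free resolution
`⋯ → F_2 → F_1 → F_0 → S/M → 0` of `S/M`, where `S = k[x_1, …, x_n]`.
`F_i` is the free `S`-module `S ^ (rank i)`, each of whose basis elements carries a multidegree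
(an exponent vector), and the maps preserve multidegrees. -/
structure MultigradedFreeResolution {k : Type*} [Field k] {n : ℕ}
    (M : Ideal (MvPolynomial (Fin n) k)) where
  /-- The rank of `F_i`. -/
  rank : ℕ → ℕ
  /-- The multidegree of a basis element of `F_i`. -/
  mdeg : (i : ℕ) → Fin (rank i) → (Fin n →₀ ℕ)
  /-- The matrix of the differential `f_{i+1} : F_{i+1} → F_i`. -/
  diff : (i : ℕ) → Matrix (Fin (rank i)) (Fin (rank (i + 1))) (MvPolynomial (Fin n) k)
  /-- The augmentation `f_0 : F_0 → S/M`. -/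
  aug : (Fin (rank 0) → MvPolynomial (Fin n) k) →ₗ[MvPolynomial (Fin n) k]
    (MvPolynomial (Fin n) k ⧸ M)
  /-- The `(a, b)` entry of `f_{i+1}` is `c x ^ (mdeg b - mdeg a)` with `c ∈ k`, and is zero if
  `x ^ mdeg a` does not divide `x ^ mdeg b`. -/
  diff_homogeneous : ∀ i a b, ∃ c : k,
    diff i a b * MvPolynomial.monomial (mdeg i a) 1 = MvPolynomial.monomial (mdeg (i + 1) b) c
  /-- A basis element of `F_0` is sent to the class of an element of `S` of its multidegree. -/
  aug_homogeneous : ∀ a, ∃ c : k,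
    aug (Pi.single a 1) = Ideal.Quotient.mk M (MvPolynomial.monomial (mdeg 0 a) c)
  aug_surjective : Function.Surjective aug
  exact_zero : Function.Exact (diff 0).mulVecLin aug
  exact_succ : ∀ i, Function.Exact (diff (i + 1)).mulVecLin (diff i).mulVecLin

namespace MultigradedFreeResolution

/-- A multigraded free resolution is minimal if none of its differential matrices has an
invertible entry. -/
def IsMinimal {k : Type*} [Field k] {n : ℕ} {M : Ideal (MvPolynomial (Fin n) k)}
    (F : MultigradedFreeResolution M) : Prop :=
  ∀ i a b, ¬ IsUnit (F.diff i a b)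

/-- `max {i | rank F_i ≠ 0}`. For a minimal resolution the ranks are the Betti numbers of `S/M`,
and this is the projective dimension of `S/M`. The value is `⊥` if all ranks vanish
(the case `M = S`) and `⊤` if there are nonzero ranks in arbitrarily high degrees. -/
noncomputable def length {k : Type*} [Field k] {n : ℕ} {M : Ideal (MvPolynomial (Fin n) k)}
    (F : MultigradedFreeResolution M) : WithBot ℕ∞ :=
  sSup ((fun i : ℕ => ((i : ℕ∞) : WithBot ℕ∞)) '' {i | F.rank i ≠ 0})

end MultigradedFreeResolution

/-! Hilbert's syzygy theorem bounds the projective dimension. For an `R[X]`-module `N`, the map `X ⊗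
1 - 1 ⊗ X` gives an exact sequence `0 → R[X] ⊗ N → R[X] ⊗ N → N → 0`, so each variable raises the
dimension by at most one (`hasProjectiveDimensionLE_polynomial`), starting from `0` over a field.

Hence in any resolution the cokernel of `F_{n+1} → F_n` is projective. In a minimal one, homogeneity
puts every matrix entry in the ideal `m` of polynomials with zero constant term; the image of
`F_{n+1}` is then a direct summand of `F_n` inside `m F_n`, and it vanishes by Krull's intersection
theorem (`eq_bot_of_projective_quotient`). So `F_{n+2} → F_{n+1}` is onto with image in `m F_{n+1}`,
which forces `F_{n+1} = 0`.

For existence, each kernel is covered by the least possible number of homogeneous generators: a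
relation with a unit coefficient would make one redundant (`MinimalSyzygy.exists_next`). -/

open CategoryTheory

/-! ### Projective dimension over polynomial rings. -/

section GlobalDimension

universe u

open scoped TensorProduct Polynomial

/-- Dimension shifting for the kernel of a surjection from a projective module. -/
theorem hasProjectiveDimensionLE_succ_iff_ker {R : Type u} [CommRing R] {P N : Type u}
    [AddCommGroup P] [Module R P] [Module.Projective R P] [AddCommGroup N] [Module R N]
    (π : P →ₗ[R] N) (hπ : Function.Surjective π) (d : ℕ) :
    HasProjectiveDimensionLE (ModuleCat.of R N) (d + 1) ↔
      HasProjectiveDimensionLE (ModuleCat.of R π.ker) d :=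
  (LinearMap.shortExact_shortComplexKer hπ).hasProjectiveDimensionLT_X₃_iff d
    (ModuleCat.projective_of_categoryTheory_projective (ModuleCat.of R P))

theorem shortExact_of_exact {R : Type u} [CommRing R] {K P N : Type u}
    [AddCommGroup K] [Module R K] [AddCommGroup P] [Module R P] [AddCommGroup N] [Module R N]
    (f : K →ₗ[R] P) (g : P →ₗ[R] N) (hf : Function.Injective f) (hg : Function.Surjective g)
    (h : Function.Exact f g) :
    (ShortComplex.mk (ModuleCat.ofHom f) (ModuleCat.ofHom g)
      (by rw [← ModuleCat.ofHom_comp, h.linearMap_comp_eq_zero]; rfl)).ShortExact where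
  exact := by
    rw [CategoryTheory.ShortComplex.ShortExact.moduleCat_exact_iff_function_exact]
    exact h
  mono_f := by
    rw [ModuleCat.mono_iff_injective]
    exact hf
  epi_g := by
    rw [ModuleCat.epi_iff_surjective]
    exact hg

/-- Flat base change does not increase the projective dimension. -/
theorem hasProjectiveDimensionLE_baseChange {R A : Type u} [CommRing R] [CommRing A] [Algebra R A]
    [Module.Flat R A] (d : ℕ) (N : Type u) [AddCommGroup N] [Module R N]
    (h : HasProjectiveDimensionLE (ModuleCat.of R N) d) :
    HasProjectiveDimensionLE (ModuleCat.of A (A ⊗[R] N)) d := by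
  induction d generalizing N with
  | zero =>
    rw [← projective_iff_hasProjectiveDimensionLE_zero, ← IsProjective.iff_projective] at h ⊢
    change Module.Projective R N at h
    change Module.Projective A (A ⊗[R] N)
    infer_instance
  | succ d ih =>
    obtain ⟨P, _, _, _, π, hπ⟩ : ∃ (P : Type u) (_ : AddCommGroup P) (_ : Module R P)
        (_ : Module.Projective R P) (π : P →ₗ[R] N), Function.Surjective π :=
      ⟨N →₀ R, inferInstance, inferInstance, inferInstance, Finsupp.linearCombination R id,
        Finsupp.linearCombination_id_surjective R N⟩
    have hk := ih _ ((hasProjectiveDimensionLE_succ_iff_ker π hπ d).mp h)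
    have hT := shortExact_of_exact (π.ker.subtype.baseChange A) (π.baseChange A)
      (Module.Flat.lTensor_preserves_injective_linearMap _ Subtype.val_injective)
      (LinearMap.lTensor_surjective A hπ)
      (Module.Flat.lTensor_exact A (LinearMap.exact_subtype_ker_map π))
    exact (hT.hasProjectiveDimensionLT_X₃_iff d
      (ModuleCat.projective_of_categoryTheory_projective (ModuleCat.of A (A ⊗[R] P)))).mpr hk

/-- The map `p ⊗ m ↦ X p ⊗ m - p ⊗ X m`, whose cokernel is `N`. -/
noncomputable def polynomialKoszul (R N : Type*) [CommRing R] [AddCommGroup N] [Module R N]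
    [Module R[X] N] [IsScalarTower R R[X] N] : R[X] ⊗[R] N →ₗ[R[X]] R[X] ⊗[R] N :=
  LinearMap.lsmul R[X] (R[X] ⊗[R] N) Polynomial.X -
    LinearMap.baseChange R[X] ((LinearMap.lsmul R[X] N Polynomial.X).restrictScalars R)

/-! ### Exactness of the Koszul sequence of an `R[X]`-module. -/

section

open Polynomial

variable {R N : Type*} [CommRing R] [AddCommGroup N] [Module R N]

/-- The `i`-th coefficient of an element of `R[X] ⊗ N`. -/
noncomputable def tensorCoeff (R N : Type*) [CommRing R] [AddCommGroup N] [Module R N] (i : ℕ) :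
    R[X] ⊗[R] N →ₗ[R] N :=
  (TensorProduct.lid R N).toLinearMap ∘ₗ (lcoeff R i).rTensor N

theorem tensorCoeff_tmul (i : ℕ) (p : R[X]) (m : N) :
    tensorCoeff R N i (p ⊗ₜ m) = p.coeff i • m := by
  simp [tensorCoeff]

theorem exists_tensorCoeff_eq_zero (t : R[X] ⊗[R] N) :
    ∃ D, ∀ i, D ≤ i → tensorCoeff R N i t = 0 := by
  induction t with
  | zero => exact ⟨0, by simp⟩
  | add x y hx hy =>
    obtain ⟨a, ha⟩ := hx
    obtain ⟨b, hb⟩ := hy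
    exact ⟨max a b, fun i hi => by
      rw [map_add, ha i (le_of_max_le_left hi), hb i (le_of_max_le_right hi), add_zero]⟩
  | tmul p m =>
    exact ⟨p.natDegree + 1, fun i hi => by
      rw [tensorCoeff_tmul, coeff_eq_zero_of_natDegree_lt (by omega), zero_smul]⟩

theorem eq_zero_of_tensorCoeff_eq_zero (t : R[X] ⊗[R] N)
    (h : ∀ i, tensorCoeff R N i t = 0) : t = 0 := by
  have key : ∀ i, TensorProduct.equivFinsuppOfBasisLeft (Polynomial.basisMonomials R) t i =
      tensorCoeff R N i t := by
    intro i
    clear h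
    induction t with
    | zero => simp
    | add x y hx hy => rw [map_add, map_add, Finsupp.add_apply, hx, hy]
    | tmul p m =>
      rw [tensorCoeff_tmul, TensorProduct.equivFinsuppOfBasisLeft_apply_tmul_apply]
      rfl
  apply (TensorProduct.equivFinsuppOfBasisLeft (N := N) (Polynomial.basisMonomials R)).injective
  ext i
  rw [key, h, map_zero, Finsupp.zero_apply]

variable [Module R[X] N] [IsScalarTower R R[X] N]

theorem polynomialKoszul_tmul (p : R[X]) (m : N) :
    polynomialKoszul R N (p ⊗ₜ m) = (X * p) ⊗ₜ m - p ⊗ₜ ((X : R[X]) • m) := by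
  simp [polynomialKoszul, TensorProduct.smul_tmul']

theorem tensorCoeff_polynomialKoszul (i : ℕ) (t : R[X] ⊗[R] N) :
    tensorCoeff R N (i + 1) (polynomialKoszul R N t) =
      tensorCoeff R N i t - (X : R[X]) • tensorCoeff R N (i + 1) t := by
  induction t with
  | zero => simp
  | add x y hx hy => simp only [map_add, hx, hy, smul_add]; abel
  | tmul p m =>
    rw [polynomialKoszul_tmul, map_sub]
    simp only [tensorCoeff_tmul, coeff_X_mul]
    rw [smul_comm]

theorem polynomialKoszul_injective : Function.Injective (polynomialKoszul R N) := by
  rw [injective_iff_map_eq_zero]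
  intro t ht
  obtain ⟨D, hD⟩ := exists_tensorCoeff_eq_zero t
  apply eq_zero_of_tensorCoeff_eq_zero
  -- On the kernel, coefficient `i` is `X` times coefficient `i + 1`, so vanishing descends from the
  -- degree bound `D`.
  have : ∀ j i, D ≤ i + j → tensorCoeff R N i t = 0 := by
    intro j
    induction j with
    | zero => exact fun i hi => hD i hi
    | succ j ih =>
      intro i hi
      have h := tensorCoeff_polynomialKoszul i t
      rw [ht, map_zero, ih (i + 1) (by omega), smul_zero, sub_zero] at h
      exact h.symm
  exact fun i => this D i (by omega)

variable (R N) in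
/-- The action map `p ⊗ m ↦ p m`. -/
noncomputable def tensorAction : R[X] ⊗[R] N →ₗ[R[X]] N :=
  LinearMap.liftBaseChange R[X] LinearMap.id

theorem tensorAction_tmul (p : R[X]) (m : N) : tensorAction R N (p ⊗ₜ m) = p • m := by
  simp [tensorAction]

theorem tensorAction_surjective : Function.Surjective (tensorAction R N) :=
  fun m => ⟨1 ⊗ₜ m, by rw [tensorAction_tmul, one_smul]⟩

theorem exact_polynomialKoszul_tensorAction :
    Function.Exact (polynomialKoszul R N) (tensorAction R N) := by
  have hcomp : ∀ t, tensorAction R N (polynomialKoszul R N t) = 0 := by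
    intro t
    induction t with
    | zero => simp
    | add x y hx hy => rw [map_add, map_add, hx, hy, add_zero]
    | tmul p m =>
      rw [polynomialKoszul_tmul, map_sub, tensorAction_tmul, tensorAction_tmul, smul_smul,
        mul_comm, sub_self]
  -- Modulo the image, powers of `X` move across the tensor sign one factor at a time.
  have hmono : ∀ (j : ℕ) (m : N),
      ((X : R[X]) ^ j) ⊗ₜ[R] m - (1 : R[X]) ⊗ₜ[R] ((X : R[X]) ^ j • m) ∈
        LinearMap.range (polynomialKoszul R N) := by
    intro j
    induction j with
    | zero => intro m; simp
    | succ j ih =>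
      intro m
      have h1 : polynomialKoszul R N ((X ^ j) ⊗ₜ m) ∈ LinearMap.range (polynomialKoszul R N) :=
        ⟨_, rfl⟩
      rw [polynomialKoszul_tmul] at h1
      have h2 := add_mem h1 (ih ((X : R[X]) • m))
      rw [sub_add_sub_cancel, smul_smul, ← pow_succ, ← pow_succ'] at h2
      exact h2
  -- Thus `t` is congruent to `1 ⊗ tensorAction R N t`, which is zero on the kernel of the action.
  have hker : ∀ t : R[X] ⊗[R] N, t - (1 : R[X]) ⊗ₜ[R] tensorAction R N t ∈
      LinearMap.range (polynomialKoszul R N) := by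
    intro t
    induction t with
    | zero => simp
    | add x y hx hy =>
      have h := add_mem hx hy
      rwa [map_add, TensorProduct.tmul_add, add_sub_add_comm]
    | tmul p m =>
      induction p using Polynomial.induction_on' with
      | add p q hp hq =>
        have h := add_mem hp hq
        rwa [TensorProduct.add_tmul, map_add, TensorProduct.tmul_add, add_sub_add_comm]
      | monomial j a =>
        have h := hmono j (a • m)
        rw [tensorAction_tmul, ← C_mul_X_pow_eq_monomial, ← smul_eq_C_mul,
          TensorProduct.smul_tmul, smul_assoc, smul_comm]
        exact h
  intro t
  constructor
  · intro ht
    have h := hker t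
    rwa [ht, TensorProduct.tmul_zero, sub_zero] at h
  · rintro ⟨s, rfl⟩
    exact hcomp s

end

theorem hasProjectiveDimensionLE_polynomial {R : Type u} [CommRing R] (d : ℕ)
    (h : ∀ N : ModuleCat.{u} R, HasProjectiveDimensionLE N d) (N : ModuleCat.{u} R[X]) :
    HasProjectiveDimensionLE N (d + 1) := by
  let _ : Module R N := Module.compHom N (Polynomial.C : R →+* R[X])
  have : IsScalarTower R R[X] N := ⟨fun a p m => by
    rw [Polynomial.smul_eq_C_mul, mul_smul]; rfl⟩
  have hb : HasProjectiveDimensionLE (ModuleCat.of R[X] (R[X] ⊗[R] N)) d :=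
    hasProjectiveDimensionLE_baseChange d N (h _)
  have hT := shortExact_of_exact (polynomialKoszul R N) (tensorAction R N)
    polynomialKoszul_injective tensorAction_surjective exact_polynomialKoszul_tensorAction
  -- `LE d` means `LT (d + 1)`: this bounds the left term, and the middle term needs only the weaker
  -- `LT (d + 2)`.
  exact hT.hasProjectiveDimensionLT_X₃ (d + 1) hb
    (hasProjectiveDimensionLT_of_ge _ (d + 1) _ (by lia))

attribute [local instance] RingHomInvPair.of_ringEquiv in
theorem hasProjectiveDimensionLE_of_ringEquiv {R R' : Type u} [CommRing R] [CommRing R']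
    (e : R ≃+* R') (d : ℕ) (h : ∀ N : ModuleCat.{u} R, HasProjectiveDimensionLE N d)
    (N : ModuleCat.{u} R') : HasProjectiveDimensionLE N d := by
  let _ : Module R N := Module.compHom N (e : R →+* R')
  let e' : ModuleCat.of R N ≃ₛₗ[RingHomClass.toRingHom e] N :=
    { AddEquiv.refl N with map_smul' := fun _ _ => rfl }
  have := h (ModuleCat.of R N)
  exact ModuleCat.hasProjectiveDimensionLE_of_semiLinearEquiv e e' d

/-- Hilbert's syzygy theorem: modules over a polynomial ring in `n` variables over a field have
projective dimension at most `n`. -/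
theorem hasProjectiveDimensionLE_mvPolynomial (k : Type u) [Field k] (n : ℕ)
    (N : ModuleCat.{u} (MvPolynomial (Fin n) k)) : HasProjectiveDimensionLE N n := by
  induction n with
  | zero =>
    refine hasProjectiveDimensionLE_of_ringEquiv
      (MvPolynomial.isEmptyRingEquiv k (Fin 0)).symm 0 (fun N => ?_) N
    rw [← projective_iff_hasProjectiveDimensionLE_zero, ← IsProjective.iff_projective]
    have : Module.Free k N := Module.Free.of_divisionRing k N
    exact Module.Projective.of_free
  | succ n ih =>
    exact hasProjectiveDimensionLE_of_ringEquiv (MvPolynomial.finSuccEquiv k n).symm.toRingEquiv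
      (n + 1) (hasProjectiveDimensionLE_polynomial n ih) N

end GlobalDimension

/-! ### Vanishing of the tail of a minimal resolution. -/

section Minimality

universe u

/-- A projective quotient of a finite free module over a Noetherian domain by a submodule
contained in a proper ideal times the free module has zero denominator. -/
theorem eq_bot_of_projective_quotient {S : Type*} [CommRing S] [IsDomain S] [IsNoetherianRing S]
    (I : Ideal S) (hI : I ≠ ⊤) {ι : Type*} [Finite ι] (K : Submodule S (ι → S))
    (hK : ∀ z ∈ K, ∀ i, z i ∈ I) [Module.Projective S ((ι → S) ⧸ K)] : K = ⊥ := by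
  classical
  have := Fintype.ofFinite ι
  obtain ⟨s, hs⟩ := Module.projective_lifting_property K.mkQ LinearMap.id K.mkQ_surjective
  -- The splitting `s` makes `e` a projection onto `K`.
  let e : (ι → S) →ₗ[S] (ι → S) := LinearMap.id - s ∘ₗ K.mkQ
  have heK : ∀ v, e v ∈ K := by
    intro v
    rw [← Submodule.ker_mkQ K, LinearMap.mem_ker]
    have h := LinearMap.congr_fun hs (K.mkQ v)
    simp only [LinearMap.comp_apply, LinearMap.id_apply] at h
    simp only [e, LinearMap.sub_apply, LinearMap.id_apply, LinearMap.comp_apply, map_sub, h,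
      sub_self]
  have hez : ∀ z ∈ K, e z = z := by
    intro z hz
    have h : K.mkQ z = 0 := by rwa [← LinearMap.mem_ker, Submodule.ker_mkQ]
    simp only [e, LinearMap.sub_apply, LinearMap.id_apply, LinearMap.comp_apply, h, map_zero,
      sub_zero]
  -- Writing `z = e z = ∑ z_a e(ε_a)` with each `e(ε_a)` in `K`, every coordinate gains one more
  -- factor from `I`.
  have hpow : ∀ (j : ℕ), ∀ z ∈ K, ∀ i, z i ∈ I ^ j := by
    intro j
    induction j with
    | zero => simp
    | succ j ih =>
      intro z hz i
      have h : z = ∑ a, z a • e (Pi.single a 1) := by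
        conv_lhs => rw [← hez z hz, pi_eq_sum_univ' z, map_sum]
        refine Finset.sum_congr rfl fun a _ => ?_
        rw [map_smul]
      rw [h, Finset.sum_apply]
      refine Ideal.sum_mem _ fun a _ => ?_
      rw [Pi.smul_apply, smul_eq_mul, pow_succ]
      exact Ideal.mul_mem_mul (ih z hz a) (hK _ (heK _) i)
  rw [eq_bot_iff]
  intro z hz
  rw [Submodule.mem_bot]
  ext i
  have h : z i ∈ ⨅ j, I ^ j := by
    rw [Ideal.mem_iInf]
    exact fun j => hpow j z hz i
  rwa [Ideal.iInf_pow_eq_bot_of_isDomain I hI] at h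

/-- A multihomogeneous polynomial (relative to shifts `a`, `b`) with nonzero constant term is a
unit. -/
theorem MvPolynomial.isUnit_of_mul_monomial_eq {k σ : Type*} [Field k] {p : MvPolynomial σ k}
    {a b : σ →₀ ℕ} {c : k} (h : p * monomial a 1 = monomial b c)
    (hp : constantCoeff p ≠ 0) : IsUnit p := by
  classical
  have h1 : coeff a (p * monomial a 1) = constantCoeff p := by
    rw [coeff_mul_monomial', if_pos le_rfl, tsub_self, mul_one, constantCoeff_eq]
  rw [h, coeff_monomial] at h1
  have hab : b = a := by
    by_contra hne
    rw [if_neg hne] at h1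
    exact hp h1.symm
  subst hab
  rw [if_pos rfl] at h1
  have h2 : p * monomial b 1 = C c * monomial b 1 := by rw [h, C_mul_monomial, mul_one]
  have h3 : p = C c := mul_right_cancel₀ (by simp) h2
  rw [h3]
  exact (isUnit_iff_ne_zero.mpr (h1 ▸ hp)).map C

namespace MultigradedFreeResolution

variable {k : Type u} [Field k] {n : ℕ} {M : Ideal (MvPolynomial (Fin n) k)}
  (F : MultigradedFreeResolution M)

/-- The cokernel of the `i`-th differential. -/
abbrev Syzygy (i : ℕ) : Type u :=
  (Fin (F.rank i) → MvPolynomial (Fin n) k) ⧸ LinearMap.range (F.diff i).mulVecLin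

theorem hasProjectiveDimensionLE_syzygy_zero (d : ℕ)
    (h : HasProjectiveDimensionLE (ModuleCat.of (MvPolynomial (Fin n) k)
      (MvPolynomial (Fin n) k ⧸ M)) d) :
    HasProjectiveDimensionLE (ModuleCat.of (MvPolynomial (Fin n) k) (F.Syzygy 0)) d := by
  let e : F.Syzygy 0 ≃ₗ[MvPolynomial (Fin n) k] (MvPolynomial (Fin n) k ⧸ M) :=
    (Submodule.quotEquivOfEq _ _ F.exact_zero.linearMap_ker_eq.symm).trans
      (F.aug.quotKerEquivOfSurjective F.aug_surjective)
  exact hasProjectiveDimensionLT_of_iso e.symm.toModuleIso (d + 1)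

/-- By exactness, `F.Syzygy (i + 1)` is the image of `F_{i+1}` in `F_i`, the kernel of `F_i →
F.Syzygy i`, so dimension shifting applies. -/
theorem hasProjectiveDimensionLE_syzygy_succ (i d : ℕ)
    (h : HasProjectiveDimensionLE (ModuleCat.of (MvPolynomial (Fin n) k) (F.Syzygy i)) (d + 1)) :
    HasProjectiveDimensionLE (ModuleCat.of (MvPolynomial (Fin n) k) (F.Syzygy (i + 1))) d := by
  have hk := (hasProjectiveDimensionLE_succ_iff_ker _ (Submodule.mkQ_surjective _) d).mp h
  let e : F.Syzygy (i + 1) ≃ₗ[MvPolynomial (Fin n) k]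
      LinearMap.ker (Submodule.mkQ (LinearMap.range (F.diff i).mulVecLin)) :=
    (Submodule.quotEquivOfEq _ _ (F.exact_succ i).linearMap_ker_eq.symm).trans
      ((F.diff i).mulVecLin.quotKerEquivRange.trans
        (LinearEquiv.ofEq _ _ (Submodule.ker_mkQ _).symm))
  exact hasProjectiveDimensionLT_of_iso e.symm.toModuleIso (d + 1)

theorem projective_syzygy (d : ℕ)
    (h : HasProjectiveDimensionLE (ModuleCat.of (MvPolynomial (Fin n) k)
      (MvPolynomial (Fin n) k ⧸ M)) d) :
    Module.Projective (MvPolynomial (Fin n) k) (F.Syzygy d) := by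
  have key : ∀ i e, i + e = d →
      HasProjectiveDimensionLE (ModuleCat.of (MvPolynomial (Fin n) k) (F.Syzygy i)) e := by
    intro i
    induction i with
    | zero =>
      intro e he
      obtain rfl : e = d := by omega
      exact F.hasProjectiveDimensionLE_syzygy_zero e h
    | succ i ih =>
      intro e he
      exact F.hasProjectiveDimensionLE_syzygy_succ i e (ih (e + 1) (by omega))
  have h0 := key d 0 (by omega)
  rw [← projective_iff_hasProjectiveDimensionLE_zero, ← IsProjective.iff_projective] at h0
  exact h0

variable {F}

theorem IsMinimal.constantCoeff_diff (hF : F.IsMinimal) (i : ℕ) (a b) :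
    MvPolynomial.constantCoeff (F.diff i a b) = 0 := by
  by_contra hne
  obtain ⟨c, hc⟩ := F.diff_homogeneous i a b
  exact hF i a b (MvPolynomial.isUnit_of_mul_monomial_eq hc hne)

theorem IsMinimal.constantCoeff_mulVec (hF : F.IsMinimal) (i : ℕ) (v) (a) :
    MvPolynomial.constantCoeff ((F.diff i).mulVecLin v a) = 0 := by
  rw [Matrix.mulVecLin_apply, Matrix.mulVec, dotProduct, map_sum]
  refine Finset.sum_eq_zero fun b _ => ?_
  rw [map_mul, hF.constantCoeff_diff, zero_mul]

theorem IsMinimal.rank_succ_eq_zero (hF : F.IsMinimal) (d : ℕ)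
    (h : HasProjectiveDimensionLE (ModuleCat.of (MvPolynomial (Fin n) k)
      (MvPolynomial (Fin n) k ⧸ M)) d) : F.rank (d + 1) = 0 := by
  have := F.projective_syzygy d h
  have hbot : LinearMap.range (F.diff d).mulVecLin = ⊥ := by
    refine eq_bot_of_projective_quotient
      (RingHom.ker (MvPolynomial.constantCoeff : MvPolynomial (Fin n) k →+* k))
      (RingHom.ker_ne_top _) _ ?_
    rintro _ ⟨v, rfl⟩ a
    exact hF.constantCoeff_mulVec d v a
  have hsurj : Function.Surjective (F.diff (d + 1)).mulVecLin := by
    rw [← LinearMap.range_eq_top, ← (F.exact_succ d).linearMap_ker_eq, LinearMap.ker_eq_top]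
    exact LinearMap.range_eq_bot.mp hbot
  by_contra hne
  -- The all-ones vector has constant terms `1`, but vectors in the image have constant terms `0`.
  obtain ⟨v, hv⟩ := hsurj 1
  have h1 := hF.constantCoeff_mulVec (d + 1) v ⟨0, Nat.pos_of_ne_zero hne⟩
  rw [hv, Pi.one_apply, map_one] at h1
  exact one_ne_zero h1

theorem IsMinimal.length_le (hF : F.IsMinimal) : F.length ≤ (n : ℕ∞) := by
  refine sSup_le ?_
  rintro _ ⟨i, hi, rfl⟩
  by_contra hlt
  have hni : n < i := by
    by_contra hle
    have h : ((i : ℕ∞) : WithBot ℕ∞) ≤ ((n : ℕ∞) : WithBot ℕ∞) := by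
      exact_mod_cast not_lt.mp hle
    exact hlt h
  obtain ⟨d, rfl⟩ : ∃ d, i = d + 1 := ⟨i - 1, by omega⟩
  refine hi (hF.rank_succ_eq_zero d ?_)
  have := hasProjectiveDimensionLE_mvPolynomial k n
    (ModuleCat.of (MvPolynomial (Fin n) k) (MvPolynomial (Fin n) k ⧸ M))
  exact hasProjectiveDimensionLT_of_ge _ (n + 1) _ (by omega)

end MultigradedFreeResolution

end Minimality

/-! ### Construction of a minimal multigraded resolution. -/

section Existence

universe u

open MvPolynomial

variable {k : Type u} [Field k] {n : ℕ} {r : ℕ}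

/-- `v` is homogeneous of multidegree `u` in the free module with generators of multidegrees
`deg`. -/
def IsMultihomogeneous (deg : Fin r → (Fin n →₀ ℕ)) (u : Fin n →₀ ℕ)
    (v : Fin r → MvPolynomial (Fin n) k) : Prop :=
  ∀ a, ∃ c : k, v a * monomial (deg a) 1 = monomial u c

/-- The component of multidegree `u` of an element of a multigraded free module. -/
noncomputable def multidegreeComponent (deg : Fin r → (Fin n →₀ ℕ)) (u : Fin n →₀ ℕ)
    (v : Fin r → MvPolynomial (Fin n) k) : Fin r → MvPolynomial (Fin n) k := by
  classical
  exact fun a => if deg a ≤ u then monomial (u - deg a) (coeff (u - deg a) (v a)) else 0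

theorem multidegreeComponent_mul_monomial (deg : Fin r → (Fin n →₀ ℕ)) (u : Fin n →₀ ℕ)
    (v : Fin r → MvPolynomial (Fin n) k) (a : Fin r) :
    multidegreeComponent deg u v a * monomial (deg a) 1 =
      monomial u (coeff u (v a * monomial (deg a) 1)) := by
  classical
  rw [coeff_mul_monomial', multidegreeComponent]
  split_ifs with h
  · rw [monomial_mul, tsub_add_cancel_of_le h]
  · rw [zero_mul, monomial_zero]

theorem isMultihomogeneous_multidegreeComponent (deg : Fin r → (Fin n →₀ ℕ)) (u : Fin n →₀ ℕ)
    (v : Fin r → MvPolynomial (Fin n) k) :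
    IsMultihomogeneous deg u (multidegreeComponent deg u v) :=
  fun a => ⟨_, multidegreeComponent_mul_monomial deg u v a⟩

theorem exists_sum_multidegreeComponent_eq (deg : Fin r → (Fin n →₀ ℕ))
    (v : Fin r → MvPolynomial (Fin n) k) :
    ∃ T : Finset (Fin n →₀ ℕ), ∑ u ∈ T, multidegreeComponent deg u v = v := by
  classical
  refine ⟨Finset.univ.biUnion fun a => (v a * monomial (deg a) 1).support, ?_⟩
  ext1 a
  have hne : (monomial (deg a) (1 : k)) ≠ 0 := by simp
  apply mul_right_cancel₀ hne
  rw [Finset.sum_apply, Finset.sum_mul]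
  simp only [multidegreeComponent_mul_monomial]
  conv_rhs => rw [← support_sum_monomial_coeff (v a * monomial (deg a) 1)]
  symm
  apply Finset.sum_subset
  · exact Finset.subset_biUnion_of_mem (fun a => (v a * monomial (deg a) (1 : k)).support)
      (Finset.mem_univ a)
  · intro u _ hu
    rw [notMem_support_iff.mp hu, monomial_zero]

/-- After multiplying coordinates by the monomials of their multidegrees, `D` acts through the
scalar matrix `c`, so it respects each multidegree separately. -/
theorem multidegreeComponent_mem_ker {s : ℕ} (deg : Fin r → (Fin n →₀ ℕ))
    (deg' : Fin s → (Fin n →₀ ℕ)) (D : Matrix (Fin r) (Fin s) (MvPolynomial (Fin n) k))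
    (hD : ∀ a b, ∃ c : k, D a b * monomial (deg a) 1 = monomial (deg' b) c)
    (u : Fin n →₀ ℕ) {v : Fin s → MvPolynomial (Fin n) k}
    (hv : v ∈ LinearMap.ker D.mulVecLin) :
    multidegreeComponent deg' u v ∈ LinearMap.ker D.mulVecLin := by
  choose c hc using hD
  have key : ∀ (w : Fin s → MvPolynomial (Fin n) k) a, D.mulVecLin w a * monomial (deg a) 1 =
      ∑ b, C (c a b) * (w b * monomial (deg' b) 1) := by
    intro w a
    rw [Matrix.mulVecLin_apply, Matrix.mulVec, dotProduct, Finset.sum_mul]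
    refine Finset.sum_congr rfl fun b _ => ?_
    have h : D a b * monomial (deg a) 1 = C (c a b) * monomial (deg' b) 1 := by
      rw [hc, C_mul_monomial, mul_one]
    linear_combination w b * h
  rw [LinearMap.mem_ker] at hv ⊢
  ext1 a
  have hne : (monomial (deg a) (1 : k)) ≠ 0 := by simp
  apply mul_right_cancel₀ hne
  have h0 := key v a
  rw [hv, Pi.zero_apply, zero_mul] at h0
  rw [key, Pi.zero_apply, zero_mul]
  simp only [multidegreeComponent_mul_monomial, C_mul_monomial]
  rw [← map_sum]
  have h1 := congrArg (coeff u) h0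
  rw [coeff_zero, coeff_sum] at h1
  simp only [coeff_C_mul] at h1
  rw [← h1, monomial_zero]

/-- A multigraded submodule of a multigraded free module of finite rank, none of whose elements
has an invertible coordinate. -/
structure MinimalSyzygy (k : Type u) [Field k] (n : ℕ) where
  /-- The rank of the ambient free module. -/
  rank : ℕ
  /-- The multidegrees of the basis. -/
  deg : Fin rank → (Fin n →₀ ℕ)
  /-- The submodule. -/
  carrier : Submodule (MvPolynomial (Fin n) k) (Fin rank → MvPolynomial (Fin n) k)
  le_span : carrier ≤ Submodule.span _ {v | v ∈ carrier ∧ ∃ u, IsMultihomogeneous deg u v}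
  not_isUnit : ∀ v ∈ carrier, ∀ a, ¬ IsUnit (v a)

namespace MinimalSyzygy

/-- `K` is generated by `m` homogeneous elements. -/
def GeneratedBy (K : MinimalSyzygy k n) (m : ℕ) : Prop :=
  ∃ (g : Fin m → (Fin K.rank → MvPolynomial (Fin n) k)) (u : Fin m → (Fin n →₀ ℕ)),
    (∀ b, IsMultihomogeneous K.deg (u b) (g b)) ∧
      Submodule.span (MvPolynomial (Fin n) k) (Set.range g) = K.carrier

theorem exists_generatedBy (K : MinimalSyzygy k n) : ∃ m, K.GeneratedBy m := by
  have heq : K.carrier =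
      Submodule.span _ {v | v ∈ K.carrier ∧ ∃ u, IsMultihomogeneous K.deg u v} :=
    le_antisymm K.le_span (Submodule.span_le.mpr fun v hv => hv.1)
  have hfg : K.carrier.FG := IsNoetherian.noetherian _
  rw [heq, Submodule.fg_span_iff_fg_span_finset_subset] at hfg
  obtain ⟨s, hs, hspan⟩ := hfg
  choose u hu using fun b : s => (hs b.2).2
  refine ⟨s.card, fun b => (s.equivFin.symm b : _), fun b => u (s.equivFin.symm b),
    fun b => hu _, ?_⟩
  rw [heq, hspan]
  congr 1
  ext v
  constructor
  · rintro ⟨b, rfl⟩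
    exact (s.equivFin.symm b).2
  · intro hv
    exact ⟨s.equivFin ⟨v, hv⟩, by simp⟩

/-- If a relation between homogeneous generators has an invertible coefficient, then one of the
generators is redundant. -/
theorem generatedBy_of_isUnit (K : MinimalSyzygy k n) {m : ℕ}
    (g : Fin m → (Fin K.rank → MvPolynomial (Fin n) k)) (u : Fin m → (Fin n →₀ ℕ))
    (hg : ∀ b, IsMultihomogeneous K.deg (u b) (g b))
    (hspan : Submodule.span (MvPolynomial (Fin n) k) (Set.range g) = K.carrier)
    (v : Fin m → MvPolynomial (Fin n) k) (hv : ∑ b, v b • g b = 0) (b₀ : Fin m)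
    (hb : IsUnit (v b₀)) : ∃ m' < m, K.GeneratedBy m' := by
  obtain ⟨m', rfl⟩ : ∃ m', m = m' + 1 := ⟨m - 1, by have := b₀.2; omega⟩
  refine ⟨m', by omega, g ∘ b₀.succAbove, u ∘ b₀.succAbove, fun b => hg _, ?_⟩
  rw [← hspan]
  apply le_antisymm
  · exact Submodule.span_mono (Set.range_comp_subset_range _ _)
  · rw [Submodule.span_le]
    have hmem : ∀ b, g (b₀.succAbove b) ∈
        Submodule.span (MvPolynomial (Fin n) k) (Set.range (g ∘ b₀.succAbove)) :=
      fun b => Submodule.subset_span ⟨b, rfl⟩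
    rintro _ ⟨b, rfl⟩
    rcases Fin.eq_self_or_eq_succAbove b₀ b with rfl | ⟨b, rfl⟩
    · rw [Fin.sum_univ_succAbove _ b] at hv
      have h1 : v b • g b ∈
          Submodule.span (MvPolynomial (Fin n) k) (Set.range (g ∘ b.succAbove)) := by
        rw [eq_neg_of_add_eq_zero_left hv]
        exact neg_mem (Submodule.sum_mem _ fun b' _ => Submodule.smul_mem _ _ (hmem b'))
      exact (Submodule.smul_mem_iff_of_isUnit _ hb).mp h1
    · exact hmem b

/-- The columns of `D` are a homogeneous generating family of least size. Its relations form a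
multigraded module because `D` preserves multidegrees, and minimality of the size excludes unit
coordinates. -/
theorem exists_next (K : MinimalSyzygy k n) :
    ∃ (K' : MinimalSyzygy k n)
      (D : Matrix (Fin K.rank) (Fin K'.rank) (MvPolynomial (Fin n) k)),
      (∀ a b, ∃ c : k, D a b * monomial (K.deg a) 1 = monomial (K'.deg b) c) ∧
      LinearMap.range D.mulVecLin = K.carrier ∧ LinearMap.ker D.mulVecLin = K'.carrier := by
  classical
  obtain ⟨g, u, hg, hspan⟩ := Nat.find_spec K.exists_generatedBy
  let D : Matrix (Fin K.rank) (Fin (Nat.find K.exists_generatedBy)) (MvPolynomial (Fin n) k) :=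
    Matrix.of fun a b => g b a
  have hD : ∀ a b, ∃ c : k, D a b * monomial (K.deg a) 1 = monomial (u b) c :=
    fun a b => hg b a
  refine ⟨⟨Nat.find K.exists_generatedBy, u, LinearMap.ker D.mulVecLin, ?_, ?_⟩, D, hD, ?_, rfl⟩
  · intro v hv
    obtain ⟨T, hT⟩ := exists_sum_multidegreeComponent_eq u v
    rw [← hT]
    refine Submodule.sum_mem _ fun d _ => Submodule.subset_span
      ⟨multidegreeComponent_mem_ker K.deg u D hD d hv, d,
        isMultihomogeneous_multidegreeComponent u d v⟩
  · intro v hv b hb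
    have hv' : ∑ b, v b • g b = 0 := by
      rw [LinearMap.mem_ker] at hv
      ext1 a
      have h := congrFun hv a
      rw [Matrix.mulVecLin_apply, Matrix.mulVec, dotProduct] at h
      rw [Finset.sum_apply, ← h]
      exact Finset.sum_congr rfl fun b _ => mul_comm _ _
    obtain ⟨m', hlt, hm'⟩ := K.generatedBy_of_isUnit g u hg hspan v hv' b hb
    exact Nat.find_min K.exists_generatedBy hlt hm'
  · rw [Matrix.range_mulVecLin]
    exact hspan

/-- The kernel of a minimal multigraded cover. -/
noncomputable def next (K : MinimalSyzygy k n) : MinimalSyzygy k n := K.exists_next.choose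

/-- The matrix of a minimal multigraded cover. -/
noncomputable def cover (K : MinimalSyzygy k n) :
    Matrix (Fin K.rank) (Fin K.next.rank) (MvPolynomial (Fin n) k) :=
  K.exists_next.choose_spec.choose

theorem cover_homogeneous (K : MinimalSyzygy k n) (a b) :
    ∃ c : k, K.cover a b * monomial (K.deg a) 1 = monomial (K.next.deg b) c :=
  K.exists_next.choose_spec.choose_spec.1 a b

theorem range_cover (K : MinimalSyzygy k n) : LinearMap.range K.cover.mulVecLin = K.carrier :=
  K.exists_next.choose_spec.choose_spec.2.1

theorem ker_cover (K : MinimalSyzygy k n) : LinearMap.ker K.cover.mulVecLin = K.next.carrier :=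
  K.exists_next.choose_spec.choose_spec.2.2

theorem not_isUnit_cover (K : MinimalSyzygy k n) (a b) : ¬ IsUnit (K.cover a b) := by
  have h : K.cover.mulVecLin (Pi.single b 1) ∈ K.carrier := by
    rw [← K.range_cover]
    exact ⟨_, rfl⟩
  have h1 := K.not_isUnit _ h a
  rwa [Matrix.mulVecLin_apply, Matrix.mulVec_single_one] at h1

/-- The iterated syzygies. -/
noncomputable def iter (K : MinimalSyzygy k n) : ℕ → MinimalSyzygy k n
  | 0 => K
  | i + 1 => (K.iter i).next

end MinimalSyzygy

theorem IsMonomialIdeal.exists_minimalSyzygy {M : Ideal (MvPolynomial (Fin n) k)}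
    (hM : IsMonomialIdeal M) :
    ∃ (K : MinimalSyzygy k n) (aug : (Fin K.rank → MvPolynomial (Fin n) k)
        →ₗ[MvPolynomial (Fin n) k] (MvPolynomial (Fin n) k ⧸ M)),
      (∀ a, ∃ c : k, aug (Pi.single a 1) = Ideal.Quotient.mk M (monomial (K.deg a) c)) ∧
      Function.Surjective aug ∧ LinearMap.ker aug = K.carrier := by
  -- For `M = ⊤` the cover must have rank `0`: the kernel of `S → 0` contains units. Otherwise `F_0
  -- = S`, generated in multidegree `0`.
  by_cases hT : M = ⊤
  · subst hT
    have := Ideal.Quotient.subsingleton_iff.mpr (rfl : (⊤ : Ideal (MvPolynomial (Fin n) k)) = ⊤)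
    refine ⟨⟨0, Fin.elim0, ⊤, ?_, fun _ _ a => a.elim0⟩, 0, fun a => a.elim0,
      fun x => ⟨0, Subsingleton.elim _ _⟩, LinearMap.ker_zero⟩
    intro v _
    rw [Subsingleton.elim v 0]
    exact zero_mem _
  · let aug : (Fin 1 → MvPolynomial (Fin n) k) →ₗ[MvPolynomial (Fin n) k]
        (MvPolynomial (Fin n) k ⧸ M) := M.mkQ ∘ₗ LinearMap.proj 0
    have haug : ∀ v, v ∈ LinearMap.ker aug ↔ v 0 ∈ M := by
      intro v
      rw [LinearMap.mem_ker]
      exact Submodule.Quotient.mk_eq_zero M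
    refine ⟨⟨1, 0, LinearMap.ker aug, ?_, ?_⟩, aug, ?_, ?_, rfl⟩
    · obtain ⟨G, hG⟩ := hM
      let L : MvPolynomial (Fin n) k →ₗ[MvPolynomial (Fin n) k]
          (Fin 1 → MvPolynomial (Fin n) k) := LinearMap.pi fun _ => LinearMap.id
      have hle : M ≤ Submodule.comap L (Submodule.span _
          {v | v ∈ LinearMap.ker aug ∧ ∃ u, IsMultihomogeneous (0 : Fin 1 → (Fin n →₀ ℕ)) u v}) := by
        conv_lhs => rw [hG]
        rw [Ideal.span, Submodule.span_le]
        rintro _ ⟨d, hd, rfl⟩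
        refine Submodule.subset_span ⟨?_, d, fun a => ⟨1, ?_⟩⟩
        · rw [haug, hG]
          exact Ideal.subset_span ⟨d, hd, rfl⟩
        · change monomial d (1 : k) * monomial 0 1 = _
          rw [monomial_mul, add_zero, mul_one]
      intro v hv
      have h := hle ((haug v).mp hv)
      have hLv : L (v 0) = v := by
        ext1 a
        rw [Subsingleton.elim a 0]
        rfl
      rwa [Submodule.mem_comap, hLv] at h
    · intro v hv a ha
      rw [Subsingleton.elim a 0] at ha
      exact hT (Ideal.eq_top_of_isUnit_mem _ ((haug v).mp hv) ha)
    · intro a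
      refine ⟨1, ?_⟩
      rw [Subsingleton.elim a 0]
      change M.mkQ ((Pi.single 0 1 : Fin 1 → MvPolynomial (Fin n) k) 0) = _
      rw [Pi.single_eq_same]
      rfl
    · intro x
      obtain ⟨p, rfl⟩ := M.mkQ_surjective x
      exact ⟨fun _ => p, rfl⟩

theorem IsMonomialIdeal.exists_isMinimal {M : Ideal (MvPolynomial (Fin n) k)}
    (hM : IsMonomialIdeal M) : ∃ F : MultigradedFreeResolution M, F.IsMinimal := by
  obtain ⟨K, aug, haug, hsurj, hker⟩ := hM.exists_minimalSyzygy
  exact ⟨{  rank := fun i => (K.iter i).rank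
            mdeg := fun i => (K.iter i).deg
            diff := fun i => (K.iter i).cover
            aug := aug
            diff_homogeneous := fun i => (K.iter i).cover_homogeneous
            aug_homogeneous := haug
            aug_surjective := hsurj
            exact_zero := LinearMap.exact_iff.mpr (hker.trans K.range_cover.symm)
            exact_succ := fun i => LinearMap.exact_iff.mpr
              ((K.iter i).ker_cover.trans (K.iter i).next.range_cover.symm) },
    fun i => (K.iter i).not_isUnit_cover⟩

end Existence

theorem theorem4p4 {k : Type*} [Field k] (n : ℕ) (M : Ideal (MvPolynomial (Fin n) k))
    (hM : IsMonomialIdeal M) :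
    (∃ F : MultigradedFreeResolution M, F.IsMinimal) ∧
    (∀ F : MultigradedFreeResolution M, F.IsMinimal → F.length ≤ (n : ℕ∞)) ∧
    CategoryTheory.projectiveDimension
      (ModuleCat.of (MvPolynomial (Fin n) k) (MvPolynomial (Fin n) k ⧸ M)) ≤ (n : ℕ∞) := by
  refine ⟨hM.exists_isMinimal, fun F hF => hF.length_le, ?_⟩
  exact (CategoryTheory.projectiveDimension_le_iff _ n).mpr
    (hasProjectiveDimensionLE_mvPolynomial k n _)
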